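/- Let $\mathbb{D}$ be the open unit disc in $\mathbb{C}$ and $\sigma$ the area measure on $\mathbb{D}$ normalized so that $\sigma(\mathbb{D})=1$. For $1<p<\infty$ let $A^p$ be the Bergman space of functions $f$ analytic in $\mathbb{D}$ with $\int_{\mathbb{D}}|f|^p\,d\sigma<\infty$. A function $k\in A^q$, $1/p+1/q=1$, is called the kernel of the functional $\varphi$ on $A^p$ if $\varphi(f)=\int_{\mathbb{D}} f\,\overline{k}\,d\sigma$ for all $f\in A^p$. For $f\in L^1(\sigma)$ let $$(\mathcal{P}f)(z)=\int_{\mathbb{D}}\frac{f(\zeta)}{(1-\overline{\zeta}z)^2}\,d\sigma(\zeta),\qquad z\in\mathbb{D},$$ be its Bergman projection. Let $1<p,r,s<\infty$ and let $N\ge 0$ be an integer. For $1\le n\le N$ let $d_n\ge 0$ be an integer, let $z_n\in\mathbb{D}$, and let $k_n$ be the kernel of the functional $f\mapsto f^{(d_n)}(z_n)$ on $A^r$. Let $k=\sum_{n=1}^N a_nk_n$ with $a_n\in\mathbb{C}$, and let $g\in A^p$. Then $k\overline{g}\in L^1(\sigma)$, and: (i) $\mathcal{P}(k\overline{g})$ lies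 in the linear span of the kernels of the functionals $f\mapsto f^{(m)}(z_n)$ on $A^s$, where $1\le n\le N$ and $0\le m\le d_n$; (ii) $\mathcal{P}(k\overline{g})\in A^p$, and it is the kernel of the functional $f\mapsto\int_{\mathbb{D}} fg\,\overline{k}\,d\sigma$ on $A^q$, where $1/p+1/q=1$. -/

import Mathlib

open MeasureTheory
open scoped ENNReal ComplexConjugate

namespace Bergman

/-- The open unit disc in the complex plane. -/
def disc : Set ℂ := Metric.ball 0 1

/-- Normalized area measure on the unit disc: Lebesgue measure restricted to the disc and divided
by the area of the disc, so that its total mass is `1`. -/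
noncomputable def area : Measure ℂ := (volume disc)⁻¹ • volume.restrict disc

/-- `f` belongs to the Bergman space `A^p`: it is holomorphic in the unit disc and its `p`-th power
is integrable there. Functions are total functions on `ℂ`; only their values on the disc matter. -/
def MemBergman (p : ℝ≥0∞) (f : ℂ → ℂ) : Prop :=
  DifferentiableOn ℂ f disc ∧ MemLp f p area

/-- The pairing `∫ f * conj k` over the disc with respect to normalized area measure. -/
noncomputable def pairing (f k : ℂ → ℂ) : ℂ := ∫ ζ, f ζ * conj (k ζ) ∂area

/-- `k` is the kernel of the functional `φ` on `A^p`: `k` belongs to `A^q`, with `q` the conjugate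
exponent of `p`, and `φ f = ∫ f * conj k` for all `f` in `A^p`. -/
def IsKernel (p : ℝ≥0∞) (φ : (ℂ → ℂ) → ℂ) (k : ℂ → ℂ) : Prop :=
  MemBergman p.conjExponent k ∧ ∀ f, MemBergman p f → φ f = pairing f k

/-- The derivative-evaluation functional `f ↦ f^{(d)}(a)`. -/
noncomputable def derivEval (d : ℕ) (a : ℂ) (f : ℂ → ℂ) : ℂ := iteratedDeriv d f a

/-- The Bergman projection. -/
noncomputable def proj (f : ℂ → ℂ) (z : ℂ) : ℂ := ∫ ζ, f ζ / (1 - conj ζ * z) ^ 2 ∂area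

end Bergman

namespace Bergman

/-! The function `derivKernel d a` is bounded on the disc and represents `f ↦ f^{(d)}(a)` on all
integrable holomorphic `f`, whatever the exponent (`pairing_derivKernel`). A kernel is determined on
the disc by its functional (`IsKernel.eqOn_derivKernel`), so each given kernel is a `derivKernel`.

With `K_w = derivKernel 0 w`, the projection at `w` is the conjugate of the pairing of `g K_w` with
`k`, that is, of a combination of derivatives of `g K_w` at the `z_n`. Leibniz's rule and the
symmetry `conj (K_w^{(m)}(z_n)) = derivKernel m z_n w` give (i) with explicit coefficients.
Leibniz's rule applied to `g f` yields the same coefficients, which is (ii). -/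

/-! ### Polar coordinates on the disc. -/

lemma polarCoord_symm_eq_circleMap (x : ℝ × ℝ) :
    Complex.polarCoord.symm x = circleMap 0 x.1 x.2 := by
  simp [circleMap, Complex.exp_mul_I]

/-- Integration in polar coordinates as an iterated integral. -/
lemma integral_eq_integral_circleMap {G : ℂ → ℂ} (hm : Measurable G) (hi : Integrable G) :
    ∫ ζ, G ζ = ∫ ρ in Set.Ioi (0 : ℝ),
      ρ • ∫ θ in (0 : ℝ)..2 * Real.pi, G (circleMap 0 ρ θ) := by
  have hmeas : Measurable fun x : ℝ × ℝ => circleMap 0 x.1 x.2 := by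
    unfold circleMap; fun_prop
  have hint : IntegrableOn (fun x : ℝ × ℝ => x.1 • G (circleMap 0 x.1 x.2))
      (Set.Ioi (0 : ℝ) ×ˢ Set.Ioo (-Real.pi) Real.pi) (volume.prod volume) := by
    refine ⟨(measurable_fst.smul (hm.comp hmeas)).aestronglyMeasurable, ?_⟩
    have h := Complex.lintegral_comp_polarCoord_symm fun ζ => ‖G ζ‖ₑ
    have h2 : ∫⁻ x in polarCoord.target, ‖x.1 • G (circleMap 0 x.1 x.2)‖ₑ = ∫⁻ ζ, ‖G ζ‖ₑ := by
      rw [← h]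
      refine setLIntegral_congr_fun polarCoord.open_target.measurableSet fun x hx => ?_
      have hx1 : 0 < x.1 := hx.1
      simp only [polarCoord_symm_eq_circleMap, enorm_smul, smul_eq_mul]
      rw [Real.enorm_of_nonneg hx1.le]
    change ∫⁻ x in polarCoord.target, ‖x.1 • G (circleMap 0 x.1 x.2)‖ₑ < ∞
    rw [h2]
    exact hi.2
  rw [← Complex.integral_comp_polarCoord_symm G]
  simp only [polarCoord_symm_eq_circleMap]
  refine (setIntegral_prod _ hint).trans ?_
  refine integral_congr_ae (Filter.Eventually.of_forall fun ρ => ?_)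
  simp only
  rw [integral_smul, ← integral_Ioc_eq_integral_Ioo,
    ← intervalIntegral.integral_of_le (by linarith [Real.pi_pos])]
  have hper : Function.Periodic (fun θ => G (circleMap 0 ρ θ)) (2 * Real.pi) := fun θ => by
    simp only [periodic_circleMap 0 ρ θ]
  have := hper.intervalIntegral_add_eq (-Real.pi) 0
  rw [zero_add, show -Real.pi + 2 * Real.pi = Real.pi by ring] at this
  rw [this]

lemma isOpen_disc : IsOpen disc := Metric.isOpen_ball

lemma mem_disc {w : ℂ} : w ∈ disc ↔ ‖w‖ < 1 := by simp [disc]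

lemma circleMap_mem_disc {ρ : ℝ} (hρ : 0 < ρ) (θ : ℝ) : circleMap 0 ρ θ ∈ disc ↔ ρ < 1 := by
  rw [mem_disc, norm_circleMap_zero, abs_of_pos hρ]

lemma setIntegral_disc_eq {F : ℂ → ℂ} (hc : ContinuousOn F disc) (hi : IntegrableOn F disc) :
    ∫ ζ in disc, F ζ = ∫ ρ in (0 : ℝ)..1,
      ρ • ∫ θ in (0 : ℝ)..2 * Real.pi, F (circleMap 0 ρ θ) := by
  have hd : MeasurableSet disc := isOpen_disc.measurableSet
  have hm : Measurable (disc.indicator F) := by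
    classical
    have := hc.measurable_piecewise (g := 0) continuousOn_const hd
    rwa [Set.piecewise_eq_indicator] at this
  rw [← integral_indicator hd,
    integral_eq_integral_circleMap hm ((integrable_indicator_iff hd).2 hi),
    intervalIntegral.integral_of_le zero_le_one, integral_Ioc_eq_integral_Ioo,
    ← integral_indicator measurableSet_Ioi, ← integral_indicator measurableSet_Ioo]
  congr 1 with ρ
  by_cases h0 : 0 < ρ
  · by_cases h1 : ρ < 1
    · rw [Set.indicator_of_mem (Set.mem_Ioi.2 h0), Set.indicator_of_mem (Set.mem_Ioo.2 ⟨h0, h1⟩)]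
      congr 2 with θ
      rw [Set.indicator_of_mem ((circleMap_mem_disc h0 θ).2 h1)]
    · rw [Set.indicator_of_mem (Set.mem_Ioi.2 h0), Set.indicator_of_notMem fun h => h1 h.2]
      have : ∀ θ, disc.indicator F (circleMap 0 ρ θ) = 0 := fun θ =>
        Set.indicator_of_notMem (fun h => h1 ((circleMap_mem_disc h0 θ).1 h)) _
      simp [this]
  · rw [Set.indicator_of_notMem (Set.notMem_Ioi.2 (not_lt.1 h0)), Set.indicator_of_notMem fun h => h0 h.1]

/-! ### Normalized area measure. -/

lemma volume_disc : volume disc = ENNReal.ofReal Real.pi := by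
  rw [disc, Complex.volume_ball]
  simp [← NNReal.coe_real_pi]

instance : IsFiniteMeasure area := by
  constructor
  rw [area, Measure.smul_apply, Measure.restrict_apply_univ, volume_disc, smul_eq_mul]
  exact ENNReal.mul_lt_top (by simp [Real.pi_pos]) (by simp)

lemma integral_area (F : ℂ → ℂ) : ∫ ζ, F ζ ∂area = (Real.pi : ℂ)⁻¹ * ∫ ζ in disc, F ζ := by
  rw [area, integral_smul_measure, volume_disc, ENNReal.toReal_inv,
    ENNReal.toReal_ofReal Real.pi_pos.le]
  simp

lemma integrable_area_iff {F : ℂ → ℂ} : Integrable F area ↔ IntegrableOn F disc := by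
  rw [area, integrable_smul_measure]
  · rfl
  · simp [volume_disc]
  · simp [volume_disc, Real.pi_pos]

lemma ae_mem_disc : ∀ᵐ ζ ∂area, ζ ∈ disc :=
  Measure.ae_smul_measure (ae_restrict_mem isOpen_disc.measurableSet) _

lemma aestronglyMeasurable_area {F : ℂ → ℂ} (hF : ContinuousOn F disc) :
    AEStronglyMeasurable F area :=
  (hF.aestronglyMeasurable isOpen_disc.measurableSet).smul_measure _

/-! ### Derivative kernels and their bounds. -/

lemma one_sub_norm_le {a ζ : ℂ} (hζ : ζ ∈ disc) : 1 - ‖a‖ ≤ ‖1 - conj ζ * a‖ := by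
  have h1 := norm_sub_norm_le 1 (conj ζ * a)
  rw [norm_mul, RCLike.norm_conj, norm_one] at h1
  nlinarith [mem_disc.1 hζ, norm_nonneg a]

lemma one_sub_ne_zero {a ζ : ℂ} (ha : a ∈ disc) (hζ : ζ ∈ disc) : 1 - conj ζ * a ≠ 0 :=
  norm_pos_iff.1 ((sub_pos.2 (mem_disc.1 ha)).trans_le (one_sub_norm_le hζ))

/-- The kernel `(d+1)! ζ^d / (1 - conj a ζ)^(d+2)` of the functional `f ↦ f^{(d)}(a)`. -/
noncomputable def derivKernel (d : ℕ) (a ζ : ℂ) : ℂ :=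
  (d + 1).factorial * ζ ^ d / (1 - conj a * ζ) ^ (d + 2)

lemma conj_derivKernel (d : ℕ) (a ζ : ℂ) : conj (derivKernel d a ζ) =
    (d + 1).factorial * conj ζ ^ d / (1 - conj ζ * a) ^ (d + 2) := by
  simp [derivKernel, mul_comm]

lemma differentiableOn_derivKernel (d : ℕ) {a : ℂ} (ha : a ∈ disc) :
    DifferentiableOn ℂ (derivKernel d a) disc := by
  unfold derivKernel
  refine DifferentiableOn.div (by fun_prop) (by fun_prop) fun ζ hζ => pow_ne_zero _ ?_
  exact one_sub_ne_zero hζ ha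

lemma norm_derivKernel_le (d : ℕ) {a ζ : ℂ} {ε : ℝ} (hε : 0 < ε) (ha : ε ≤ 1 - ‖a‖)
    (hζ : ζ ∈ disc) : ‖derivKernel d a ζ‖ ≤ (d + 1).factorial / ε ^ (d + 2) := by
  rw [← RCLike.norm_conj, conj_derivKernel, norm_div, norm_mul, norm_pow, norm_pow,
    RCLike.norm_conj, RCLike.norm_natCast]
  have := one_sub_norm_le (a := a) hζ
  have h2 : ‖ζ‖ ^ d ≤ 1 := pow_le_one₀ (norm_nonneg _) (mem_disc.1 hζ).le
  gcongr
  · exact mul_le_of_le_one_right (by positivity) h2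
  · exact ha.trans this

lemma exists_norm_derivKernel_le (d : ℕ) {a : ℂ} (ha : a ∈ disc) :
    ∃ C, ∀ ζ ∈ disc, ‖derivKernel d a ζ‖ ≤ C :=
  ⟨_, fun _ hζ => norm_derivKernel_le d (sub_pos.2 (mem_disc.1 ha)) le_rfl hζ⟩

lemma memLp_derivKernel (d : ℕ) {a : ℂ} (ha : a ∈ disc) (p : ℝ≥0∞) :
    MemLp (derivKernel d a) p area := by
  obtain ⟨C, hC⟩ := exists_norm_derivKernel_le d ha
  exact .of_bound (aestronglyMeasurable_area (differentiableOn_derivKernel d ha).continuousOn) C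
    (ae_mem_disc.mono hC)

lemma memBergman_derivKernel (d : ℕ) {a : ℂ} (ha : a ∈ disc) (p : ℝ≥0∞) :
    MemBergman p (derivKernel d a) :=
  ⟨differentiableOn_derivKernel d ha, memLp_derivKernel d ha p⟩

lemma integrable_mul_conj_derivKernel (d : ℕ) {a : ℂ} (ha : a ∈ disc) {f : ℂ → ℂ}
    (hf : Integrable f area) : Integrable (fun ζ => f ζ * conj (derivKernel d a ζ)) area := by
  obtain ⟨C, hC⟩ := exists_norm_derivKernel_le d ha
  refine hf.mul_bdd (c := C) ?_ (ae_mem_disc.mono fun ζ hζ => ?_)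
  · exact Complex.continuous_conj.comp_aestronglyMeasurable
      (aestronglyMeasurable_area (differentiableOn_derivKernel d ha).continuousOn)
  · simpa using hC ζ hζ

/-! ### The reproducing property. -/

/-- Cauchy's formula on the circle of radius `ρ`, in the form of a mean against the
Bergman kernel. -/
lemma integral_circleMap_mul_conj_derivKernel {f : ℂ → ℂ} (hf : DifferentiableOn ℂ f disc)
    {a : ℂ} (ha : a ∈ disc) {ρ : ℝ} (h0 : 0 < ρ) (h1 : ρ < 1) :
    ∫ θ in (0 : ℝ)..2 * Real.pi,
      f (circleMap 0 ρ θ) * conj (derivKernel 0 a (circleMap 0 ρ θ)) =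
      2 * Real.pi * deriv (fun w => w * f w) ((ρ : ℂ) ^ 2 * a) := by
  have hw : (ρ : ℂ) ^ 2 * a ∈ Metric.ball (0 : ℂ) ρ := by
    rw [mem_ball_zero_iff, norm_mul, norm_pow, Complex.norm_real, Real.norm_of_nonneg h0.le]
    have := mem_disc.1 ha
    nlinarith [mul_pos h0 h0, norm_nonneg a]
  have hc : Metric.closedBall (0 : ℂ) ρ ⊆ disc := Metric.closedBall_subset_ball h1
  have hh : DifferentiableOn ℂ (fun w => w * f w) disc := differentiableOn_id.mul hf
  have key := Complex.two_pi_I_inv_smul_circleIntegral_sub_sq_inv_smul_of_differentiable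
    isOpen_disc hc hh hw
  rw [inv_smul_eq_iff₀ Complex.two_pi_I_ne_zero] at key
  have hcirc : (∮ ζ in C(0, ρ), ((ζ - (ρ : ℂ) ^ 2 * a) ^ 2)⁻¹ • (ζ * f ζ)) =
      Complex.I * ∫ θ in (0 : ℝ)..2 * Real.pi,
        f (circleMap 0 ρ θ) * conj (derivKernel 0 a (circleMap 0 ρ θ)) := by
    rw [circleIntegral, ← intervalIntegral.integral_const_mul]
    congr 1 with θ
    rw [conj_derivKernel, deriv_circleMap]
    set c := circleMap 0 ρ θ with hcdef
    have hcn : ‖c‖ = ρ := by rw [hcdef, norm_circleMap_zero, abs_of_pos h0]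
    have hc0 : c ≠ 0 := norm_pos_iff.1 (hcn ▸ h0)
    -- On `|c| = ρ` the kernel thus becomes `c² / (c - ρ² a)²`; since `dc = i c dθ`, the mean is
    -- Cauchy's integral for the derivative of `w f(w)` at `ρ² a`.
    have hcc : conj c = (ρ : ℂ) ^ 2 / c := by
      rw [eq_div_iff hc0, mul_comm, Complex.mul_conj, Complex.normSq_eq_norm_sq, hcn]
      push_cast; rfl
    have hsub : 1 - conj c * a = (c - (ρ : ℂ) ^ 2 * a) / c := by
      rw [hcc]; field_simp
    have hne : c - (ρ : ℂ) ^ 2 * a ≠ 0 := by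
      intro h
      have hcd : c ∈ disc := mem_disc.2 (hcn ▸ h1)
      exact one_sub_ne_zero ha hcd (by rw [hsub, h, zero_div])
    rw [hsub]
    simp only [smul_eq_mul, zero_add, Nat.factorial_one, Nat.cast_one, pow_zero,
      mul_one]
    field_simp
  rw [hcirc, smul_eq_mul] at key
  exact mul_left_cancel₀ Complex.I_ne_zero (key.trans (by ring))

/-- The reproducing property of the Bergman kernel for integrable holomorphic functions. -/
lemma pairing_derivKernel_zero {f : ℂ → ℂ} (hf : DifferentiableOn ℂ f disc)
    (hi : Integrable f area) {a : ℂ} (ha : a ∈ disc) : pairing f (derivKernel 0 a) = f a := by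
  have hcont : ContinuousOn (fun ζ => f ζ * conj (derivKernel 0 a ζ)) disc :=
    hf.continuousOn.mul
      (Complex.continuous_conj.comp_continuousOn (differentiableOn_derivKernel 0 ha).continuousOn)
  rw [pairing, integral_area, setIntegral_disc_eq hcont
    (integrable_area_iff.1 (integrable_mul_conj_derivKernel 0 ha hi))]
  have hmem : ∀ ρ ∈ Set.uIcc (0 : ℝ) 1, (ρ : ℂ) ^ 2 * a ∈ disc := fun ρ hρ => by
    rw [Set.uIcc_of_le zero_le_one] at hρ
    rw [mem_disc, norm_mul, norm_pow, Complex.norm_real, Real.norm_of_nonneg hρ.1]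
    have := mem_disc.1 ha
    nlinarith [hρ.1, hρ.2, norm_nonneg a, pow_le_one₀ (n := 2) hρ.1 hρ.2]
  have hdiff : ∀ w ∈ disc, HasDerivAt f (deriv f w) w := fun w hw =>
    (hf.differentiableAt (isOpen_disc.mem_nhds hw)).hasDerivAt
  have hh : DifferentiableOn ℂ (fun w => w * f w) disc := differentiableOn_id.mul hf
  -- The radial integrand has primitive `π ρ² f(ρ² a)`, smooth up to `ρ = 1` because `a` lies inside
  -- the disc; its increment is `π f(a)`.
  have hder : ∀ ρ ∈ Set.uIcc (0 : ℝ) 1,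
      HasDerivAt (fun ρ : ℝ => (Real.pi : ℂ) * ((ρ : ℂ) ^ 2 * f ((ρ : ℂ) ^ 2 * a)))
        (ρ * (2 * Real.pi * deriv (fun w => w * f w) ((ρ : ℂ) ^ 2 * a))) ρ := fun ρ hρ => by
    have hw := hdiff _ (hmem ρ hρ)
    have hsq : HasDerivAt (fun z : ℂ => z ^ 2) (2 * (ρ : ℂ)) ρ := by
      simpa using hasDerivAt_pow 2 (ρ : ℂ)
    have hcomp := HasDerivAt.comp (ρ : ℂ) hw (hsq.mul_const a)
    have hprod := ((hsq.mul hcomp).const_mul (Real.pi : ℂ)).comp_ofReal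
    have hd : deriv (fun w => w * f w) ((ρ : ℂ) ^ 2 * a) =
        1 * f ((ρ : ℂ) ^ 2 * a) + (ρ : ℂ) ^ 2 * a * deriv f ((ρ : ℂ) ^ 2 * a) :=
      ((hasDerivAt_id _).mul hw).deriv
    refine hprod.congr_deriv ?_
    rw [hd]
    simp only [Function.comp]
    ring
  have hci : ContinuousOn (fun ρ : ℝ => (ρ : ℂ) *
      (2 * Real.pi * deriv (fun w => w * f w) ((ρ : ℂ) ^ 2 * a))) (Set.uIcc 0 1) := by
    have hmap : ContinuousOn (fun ρ : ℝ => (ρ : ℂ) ^ 2 * a) (Set.uIcc 0 1) := by fun_prop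
    have := (hh.deriv isOpen_disc).continuousOn.comp hmap hmem
    exact Complex.continuous_ofReal.continuousOn.mul (continuousOn_const.mul this)
  have hcongr : ∫ ρ in (0 : ℝ)..1, ρ • ∫ θ in (0 : ℝ)..2 * Real.pi,
        f (circleMap 0 ρ θ) * conj (derivKernel 0 a (circleMap 0 ρ θ)) =
      ∫ ρ in (0 : ℝ)..1, (ρ : ℂ) *
        (2 * Real.pi * deriv (fun w => w * f w) ((ρ : ℂ) ^ 2 * a)) := by
    simp only [intervalIntegral.integral_of_le zero_le_one, integral_Ioc_eq_integral_Ioo]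
    refine setIntegral_congr_fun measurableSet_Ioo fun ρ hρ => ?_
    rw [integral_circleMap_mul_conj_derivKernel hf ha hρ.1 hρ.2, Complex.real_smul]
  rw [hcongr, intervalIntegral.integral_eq_sub_of_hasDerivAt hder hci.intervalIntegrable]
  have hpi : (Real.pi : ℂ) ≠ 0 := by exact_mod_cast Real.pi_ne_zero
  simp [hpi]

/-! ### Differentiating the reproducing formula in the base point. -/

lemma hasDerivAt_conj_derivKernel (d : ℕ) {a ζ : ℂ} (ha : a ∈ disc) (hζ : ζ ∈ disc) :
    HasDerivAt (fun b => conj (derivKernel d b ζ)) (conj (derivKernel (d + 1) a ζ)) a := by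
  simp only [conj_derivKernel]
  have hne := one_sub_ne_zero ha hζ
  have h1 : HasDerivAt (fun b : ℂ => 1 - conj ζ * b) (-conj ζ) a := by
    simpa using ((hasDerivAt_id a).const_mul (conj ζ)).const_sub 1
  have h2 := ((h1.pow (d + 2)).inv (pow_ne_zero _ hne)).const_mul
    (((d + 1).factorial : ℂ) * conj ζ ^ d)
  refine h2.congr_deriv ?_
  rw [Nat.factorial_succ (d + 1)]
  push_cast
  simp only [Pi.pow_apply]
  field_simp
  ring

lemma hasDerivAt_pairing_derivKernel (d : ℕ) {f : ℂ → ℂ} (hi : Integrable f area) {a : ℂ}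
    (ha : a ∈ disc) : HasDerivAt (fun b => pairing f (derivKernel d b))
      (pairing f (derivKernel (d + 1) a)) a := by
  -- Half the distance from `a` to the circle: points within `ε` of `a` keep distance at least `ε`
  -- from it, so one bound dominates all the derivatives.
  set ε := (1 - ‖a‖) / 2 with hεdef
  have hε : 0 < ε := half_pos (sub_pos.2 (mem_disc.1 ha))
  have hball : ∀ b ∈ Metric.ball a ε, ε ≤ 1 - ‖b‖ := fun b hb => by
    have h1 : ‖b - a‖ < ε := by rwa [← dist_eq_norm]
    have h2 := norm_le_norm_add_norm_sub' b a
    linarith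
  have hbd : ∀ b ∈ Metric.ball a ε, b ∈ disc := fun b hb => mem_disc.2 (by linarith [hball b hb])
  refine (hasDerivAt_integral_of_dominated_loc_of_deriv_le
    (F := fun b ζ => f ζ * conj (derivKernel d b ζ))
    (F' := fun b ζ => f ζ * conj (derivKernel (d + 1) b ζ))
    (bound := fun ζ => ‖f ζ‖ * ((d + 1 + 1).factorial / ε ^ (d + 1 + 2)))
    (Metric.ball_mem_nhds a hε) ?_ ?_ ?_ ?_ ?_ ?_).2
  · filter_upwards [Metric.ball_mem_nhds a hε] with b hb
    exact (integrable_mul_conj_derivKernel d (hbd b hb) hi).aestronglyMeasurable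
  · exact integrable_mul_conj_derivKernel d ha hi
  · exact (integrable_mul_conj_derivKernel (d + 1) ha hi).aestronglyMeasurable
  · filter_upwards [ae_mem_disc] with ζ hζ b hb
    rw [norm_mul, RCLike.norm_conj]
    gcongr
    exact norm_derivKernel_le (d + 1) hε (hball b hb) hζ
  · exact hi.norm.mul_const _
  · filter_upwards [ae_mem_disc] with ζ hζ b hb
    exact (hasDerivAt_conj_derivKernel d (hbd b hb) hζ).const_mul (f ζ)

/-- `derivKernel d a` represents `f ↦ f^{(d)}(a)` on integrable holomorphic functions. -/
lemma pairing_derivKernel {f : ℂ → ℂ} (hf : DifferentiableOn ℂ f disc)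
    (hi : Integrable f area) (d : ℕ) {a : ℂ} (ha : a ∈ disc) :
    pairing f (derivKernel d a) = iteratedDeriv d f a := by
  induction d generalizing a with
  | zero => rw [iteratedDeriv_zero, pairing_derivKernel_zero hf hi ha]
  | succ d ih =>
    rw [iteratedDeriv_succ, ← (hasDerivAt_pairing_derivKernel d hi ha).deriv]
    refine Filter.EventuallyEq.deriv_eq ?_
    filter_upwards [isOpen_disc.mem_nhds ha] with b hb using ih hb

/-! ### Kernels of functionals and their uniqueness. -/

lemma pairing_congr {f f' k k' : ℂ → ℂ} (hf : Set.EqOn f f' disc) (hk : Set.EqOn k k' disc) :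
    pairing f k = pairing f' k' :=
  integral_congr_ae (ae_mem_disc.mono fun ζ hζ => by simp only [hf hζ, hk hζ])

lemma conj_pairing (f k : ℂ → ℂ) : conj (pairing f k) = pairing k f := by
  rw [pairing, pairing, ← integral_conj]
  simp [mul_comm]

lemma MemBergman.integrable {p : ℝ≥0∞} (hp : 1 ≤ p) {f : ℂ → ℂ} (hf : MemBergman p f) :
    Integrable f area :=
  hf.2.integrable hp

lemma one_le_conjExponent (p : ℝ≥0∞) : 1 ≤ p.conjExponent := le_self_add

lemma isKernel_derivKernel {p : ℝ≥0∞} (hp : 1 ≤ p) (d : ℕ) {a : ℂ} (ha : a ∈ disc) :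
    IsKernel p (derivEval d a) (derivKernel d a) :=
  ⟨memBergman_derivKernel d ha _, fun _ hf =>
    (pairing_derivKernel hf.1 (hf.integrable hp) d ha).symm⟩

/-- The kernel of a derivative evaluation is unique on the disc. -/
lemma IsKernel.eqOn_derivKernel {p : ℝ≥0∞} (hp : 1 ≤ p) {d : ℕ} {a : ℂ} (ha : a ∈ disc)
    {κ : ℂ → ℂ} (hκ : IsKernel p (derivEval d a) κ) : Set.EqOn κ (derivKernel d a) disc := by
  intro w hw
  -- Testing the functional on `K_w` recovers the conjugate of the value at `w` of any of its
  -- kernels.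
  have h1 := hκ.2 _ (memBergman_derivKernel 0 hw p)
  have h2 := (isKernel_derivKernel hp d ha).2 _ (memBergman_derivKernel 0 hw p)
  rw [← pairing_derivKernel_zero hκ.1.1 (hκ.1.integrable (one_le_conjExponent p)) hw,
    ← pairing_derivKernel_zero (differentiableOn_derivKernel d ha)
      ((memLp_derivKernel d ha 1).integrable le_rfl) hw,
    ← conj_pairing, ← h1, h2, conj_pairing]

/-! ### Projection of the product, by Leibniz's rule. -/

/-- Pairing with a linear combination of derivative kernels. -/
lemma pairing_sum_derivKernel {ι : Type*} (S : Finset ι) (c : ι → ℂ) (d : ι → ℕ) (z : ι → ℂ)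
    (hz : ∀ i, z i ∈ disc) {f : ℂ → ℂ} (hf : DifferentiableOn ℂ f disc) (hi : Integrable f area) :
    pairing f (fun w => ∑ i ∈ S, c i * derivKernel (d i) (z i) w) =
      ∑ i ∈ S, conj (c i) * iteratedDeriv (d i) f (z i) := by
  have h : ∀ ζ, f ζ * conj (∑ i ∈ S, c i * derivKernel (d i) (z i) ζ) =
      ∑ i ∈ S, conj (c i) * (f ζ * conj (derivKernel (d i) (z i) ζ)) := fun ζ => by
    rw [map_sum, Finset.mul_sum]
    exact Finset.sum_congr rfl fun i _ => by rw [map_mul]; ring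
  simp only [pairing, h]
  rw [integral_finsetSum _ fun i _ => (integrable_mul_conj_derivKernel _ (hz i) hi).const_mul _]
  refine Finset.sum_congr rfl fun i _ => ?_
  rw [integral_const_mul, ← pairing_derivKernel hf hi _ (hz i), pairing]

lemma iteratedDeriv_mul_of_differentiableOn {f g : ℂ → ℂ} (hf : DifferentiableOn ℂ f disc)
    (hg : DifferentiableOn ℂ g disc) (d : ℕ) {a : ℂ} (ha : a ∈ disc) :
    iteratedDeriv d (fun ζ => f ζ * g ζ) a = ∑ i ∈ Finset.range (d + 1),
      (d.choose i : ℂ) * iteratedDeriv i f a * iteratedDeriv (d - i) g a :=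
  iteratedDeriv_fun_mul (hf.analyticAt (isOpen_disc.mem_nhds ha)).contDiffAt
    (hg.analyticAt (isOpen_disc.mem_nhds ha)).contDiffAt

/-- Conjugating makes the function paired with `k` holomorphic in `ζ`, so derivative kernels in `k`
act on it as evaluations. -/
lemma proj_eq_conj_pairing (k g : ℂ → ℂ) (z : ℂ) :
    proj (fun ζ => k ζ * conj (g ζ)) z = conj (pairing (fun ζ => g ζ * derivKernel 0 z ζ) k) := by
  rw [proj, pairing, ← integral_conj]
  refine integral_congr_ae (Filter.Eventually.of_forall fun ζ => ?_)
  simp only [map_mul, conj_derivKernel, Complex.conj_conj]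
  simp
  ring

/-- The Bergman projection of `k * conj g` for `k` a combination of derivative kernels. -/
lemma proj_sum_derivKernel_mul_conj {ι : Type*} (S : Finset ι) (c : ι → ℂ) (d : ι → ℕ)
    (z : ι → ℂ) (hz : ∀ i, z i ∈ disc) {g : ℂ → ℂ} (hg : DifferentiableOn ℂ g disc)
    (hi : Integrable g area) {w : ℂ} (hw : w ∈ disc) :
    proj (fun ζ => (∑ i ∈ S, c i * derivKernel (d i) (z i) ζ) * conj (g ζ)) w =
      ∑ x ∈ S.sigma fun i => Finset.range (d i + 1),
        (c x.1 * (d x.1).choose x.2 * conj (iteratedDeriv x.2 g (z x.1))) *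
          derivKernel (d x.1 - x.2) (z x.1) w := by
  obtain ⟨C, hC⟩ := exists_norm_derivKernel_le 0 hw
  have hdk := differentiableOn_derivKernel 0 hw
  have hint : Integrable (fun ζ => g ζ * derivKernel 0 w ζ) area :=
    hi.mul_bdd (c := C) (aestronglyMeasurable_area hdk.continuousOn) (ae_mem_disc.mono hC)
  have hmul : DifferentiableOn ℂ (fun ζ => g ζ * derivKernel 0 w ζ) disc := hg.mul hdk
  rw [proj_eq_conj_pairing, pairing_sum_derivKernel S c d z hz hmul hint, map_sum,
    Finset.sum_sigma]
  refine Finset.sum_congr rfl fun i _ => ?_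
  rw [map_mul, Complex.conj_conj, iteratedDeriv_mul_of_differentiableOn hg hdk _ (hz i), map_sum,
    Finset.mul_sum]
  refine Finset.sum_congr rfl fun j _ => ?_
  -- Both sides come from the pairing of `K_w` with a derivative kernel, evaluated by reproducing in
  -- either slot.
  have hker : conj (iteratedDeriv (d i - j) (derivKernel 0 w) (z i)) =
      derivKernel (d i - j) (z i) w := by
    rw [← pairing_derivKernel hdk ((memLp_derivKernel 0 hw 1).integrable le_rfl) _ (hz i),
      conj_pairing, pairing_derivKernel_zero (differentiableOn_derivKernel _ (hz i))
        ((memLp_derivKernel _ (hz i) 1).integrable le_rfl) hw]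
  rw [map_mul, map_mul, hker, map_natCast]
  ring

end Bergman

theorem mainTheorem8 (p r s : ℝ≥0∞) (hp : 1 < p) (hp' : p ≠ ∞) (hr : 1 < r) (hr' : r ≠ ∞)
    (hs : 1 < s) (hs' : s ≠ ∞)
    (N : ℕ) (d : Fin N → ℕ) (z : Fin N → ℂ) (hz : ∀ n, z n ∈ Bergman.disc)
    (κ : Fin N → ℂ → ℂ) (hκ : ∀ n, Bergman.IsKernel r (Bergman.derivEval (d n) (z n)) (κ n))
    (a : Fin N → ℂ) (k : ℂ → ℂ) (hk : ∀ w ∈ Bergman.disc, k w = ∑ n, a n * κ n w)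
    (g : ℂ → ℂ) (hg : Bergman.MemBergman p g) :
    Integrable (fun ζ => k ζ * conj (g ζ)) Bergman.area ∧
    (∃ h ∈ Submodule.span ℂ {κ' : ℂ → ℂ | ∃ (n : Fin N) (m : ℕ), m ≤ d n ∧
        Bergman.IsKernel s (Bergman.derivEval m (z n)) κ'},
      Set.EqOn (Bergman.proj (fun ζ => k ζ * conj (g ζ))) h Bergman.disc) ∧
    Bergman.IsKernel p.conjExponent (fun f => Bergman.pairing (fun ζ => f ζ * g ζ) k)
      (Bergman.proj (fun ζ => k ζ * conj (g ζ))) := by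
  open Bergman in
  have hgi : Integrable g area := hg.integrable hp.le
  have hk' : Set.EqOn k (fun w => ∑ n, a n * derivKernel (d n) (z n) w) disc := fun w hw => by
    rw [hk w hw]
    exact Finset.sum_congr rfl fun n _ => by rw [(hκ n).eqOn_derivKernel hr.le (hz n) hw]
  set T : Finset (Σ _ : Fin N, ℕ) := Finset.univ.sigma fun n => Finset.range (d n + 1)
  -- The index `(n, i)` marks the Leibniz term with `i` derivatives on `g`, leaving a kernel of
  -- order `d n - i`.
  set c : (Σ _ : Fin N, ℕ) → ℂ := fun x =>
    a x.1 * (d x.1).choose x.2 * conj (iteratedDeriv x.2 g (z x.1)) with hc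
  set h : ℂ → ℂ := fun w => ∑ x ∈ T, c x * derivKernel (d x.1 - x.2) (z x.1) w with hh
  have hproj : Set.EqOn (proj fun ζ => k ζ * conj (g ζ)) h disc := fun w hw => by
    refine Eq.trans ?_ (proj_sum_derivKernel_mul_conj Finset.univ a d z hz hg.1 hgi hw)
    exact integral_congr_ae (ae_mem_disc.mono fun ζ hζ => by simp only [hk' hζ])
  refine ⟨?_, ⟨h, ?_, hproj⟩, ⟨?_, ?_⟩, fun f hf => ?_⟩
  · have hsum : Integrable (fun ζ => ∑ n, a n * conj (g ζ * conj (derivKernel (d n) (z n) ζ)))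
        area := integrable_finsetSum _ fun n _ =>
      ((Complex.conjCLE.integrable_comp_iff).2
        (integrable_mul_conj_derivKernel (d n) (hz n) hgi)).const_mul _
    refine hsum.congr (ae_mem_disc.mono fun ζ hζ => ?_)
    simp only [hk' hζ, Finset.sum_mul, map_mul, Complex.conj_conj]
    exact Finset.sum_congr rfl fun n _ => by ring
  · have : h = ∑ x ∈ T, c x • derivKernel (d x.1 - x.2) (z x.1) := by
      ext w; simp [hh]
    rw [this]
    exact Submodule.sum_mem _ fun x _ => Submodule.smul_mem _ _ <| Submodule.subset_span
      ⟨x.1, d x.1 - x.2, Nat.sub_le _ _, isKernel_derivKernel hs.le _ (hz _)⟩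
  · refine DifferentiableOn.congr ?_ hproj
    exact DifferentiableOn.fun_sum fun x _ =>
      (differentiableOn_derivKernel _ (hz _)).const_mul _
  -- Finite sums of bounded kernels lie in every `L^t`, so the double conjugate exponent need not be
  -- identified with `p`.
  · have hmem : MemLp h p.conjExponent.conjExponent area :=
      memLp_finsetSum _ fun x _ => (memLp_derivKernel _ (hz _) _).const_mul _
    exact hmem.ae_eq (ae_mem_disc.mono fun ζ hζ => (hproj hζ).symm)
  · have := ENNReal.HolderConjugate.conjExponent hp.le
    have hfg : Integrable (fun ζ => f ζ * g ζ) area := by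
      have := hg.2.integrable_mul hf.2
      exact this.congr (Filter.Eventually.of_forall fun ζ => mul_comm _ _)
    have hmul : DifferentiableOn ℂ (fun ζ => f ζ * g ζ) disc := hf.1.mul hg.1
    rw [pairing_congr (fun _ _ => rfl) hproj]
    refine (pairing_congr (fun _ _ => rfl) hk').trans ?_
    rw [pairing_sum_derivKernel _ a d z hz hmul hfg,
      pairing_sum_derivKernel T c (fun x => d x.1 - x.2) (fun x => z x.1) (fun x => hz _) hf.1
        (hf.integrable (one_le_conjExponent p)), Finset.sum_sigma]
    refine Finset.sum_congr rfl fun n _ => ?_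
    -- Putting `g` first makes the Leibniz index count derivatives of `g`, as in `c`.
    simp only [mul_comm (f _)]
    rw [iteratedDeriv_mul_of_differentiableOn hg.1 hf.1 _ (hz n), Finset.mul_sum]
    refine Finset.sum_congr rfl fun i _ => ?_
    simp only [hc, map_mul, map_natCast, Complex.conj_conj]
    ring
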